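/- Let $m,n\in\mathbb N$. Let $\mathbf H\in\mathbb C^{n\times m}$ be a random matrix with an arbitrary distribution, and let $\mathbf z\in\mathbb C^n$ be a circular random vector, i.e. $e^{2\pi i\theta}\mathbf z$ has the same distribution as $\mathbf z$ for every $\theta\in[0,1)$. For a random input $\mathbf x\in\mathbb C^m$ such that $\mathbf x,\mathbf H,\mathbf z$ are independent, put $\mathbf y=\mathbf H\mathbf x+\mathbf z$, and let $I(\mathbf x;\mathbf y,\mathbf H)\in[0,\infty]$ be the mutual information of $\mathbf x$ and the pair $(\mathbf y,\mathbf H)$ (the receiver knows $\mathbf H$), i.e. the Kullback–Leibler divergence of the joint law of $\mathbf x$ and $(\mathbf y,\mathbf H)$ from the product of the two marginal laws. It depends only on the distributions of $\mathbf x,\mathbf H,\mathbf z$. The circular analog of a random vector $\mathbf x$ is $\mathbf x_{(\mathrm a)}=e^{2\pi i\psi}\mathbf x$, where $\psi$ is uniformly distributed on $[0,1)$ and independent of $\mathbf x$. Let $\mathcal I$ be a set of probability distributions on $\mathbb C^m$ (the admissible input distributions; $\mathbf x\in\mathcal I$ means that the distribution of $\mathbf x$ is in $\mathcal I$) that is circular-closed: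 $\mathbf x\in\mathcal I$ implies $\mathbf x_{(\mathrm a)}\in\mathcal I$. The coherent capacity is $$C_{\mathrm c}=\sup_{\mathbf x\in\mathcal I} I(\mathbf x;\mathbf y,\mathbf H),$$ and $\mathbf x$ is said to achieve it if $\mathbf x\in\mathcal I$ and $I(\mathbf x;\mathbf y,\mathbf H)=C_{\mathrm c}$. Theorem. Suppose that some (not necessarily circular) input achieves the coherent capacity. Then there exists a circular random vector $\mathbf x\in\mathbb C^m$ that achieves the coherent capacity. More precisely, whenever $\mathbf x'$ achieves the coherent capacity, its circular analog $\mathbf x'_{(\mathrm a)}$ is circular and achieves it as well. -/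

import Mathlib

open MeasureTheory
open scoped ENNReal

noncomputable section

namespace CoherentChannel

/-- A random vector with law `μ` on `ℂᵏ` is circular: it has the same distribution as
`e^{2πiθ} x` for every deterministic `θ ∈ [0,1)`. -/
def IsCircular {k : ℕ} (μ : Measure (Fin k → ℂ)) : Prop :=
  ∀ θ ∈ Set.Ico (0 : ℝ) 1,
    μ.map (fun x => Complex.exp (2 * Real.pi * θ * Complex.I) • x) = μ

/-- The law of the circular analog `e^{2πiψ} x`, where `x` has law `μ` and `ψ` is uniform on
`[0,1)` and independent of `x`. -/
def circularAnalog {k : ℕ} (μ : Measure (Fin k → ℂ)) : Measure (Fin k → ℂ) :=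
  (((volume : Measure ℝ).restrict (Set.Ico 0 1)).prod μ).map
    (fun p => Complex.exp (2 * Real.pi * p.1 * Complex.I) • p.2)

/-- A set of input distributions closed under forming the circular analog. -/
def CircularClosed {k : ℕ} (S : Set (Measure (Fin k → ℂ))) : Prop :=
  ∀ μ ∈ S, circularAnalog μ ∈ S

/-- Mutual information `I(X; Y) ∈ [0, ∞]` (in nats) of two random elements on a common probability
space: the Kullback-Leibler divergence of the joint law from the product of the marginal laws.
If the joint law has a density, this is `∫ f_{X,Y} log (f_{X,Y} / (f_X f_Y))`. -/
def mutualInfo {Ω E F : Type*} [MeasurableSpace Ω] [MeasurableSpace E] [MeasurableSpace F]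
    (P : Measure Ω) (X : Ω → E) (Y : Ω → F) : ℝ≥0∞ :=
  InformationTheory.klDiv (P.map fun ω => (X ω, Y ω)) ((P.map X).prod (P.map Y))

/-- `ℂ^{n×m}` as the space of values of the channel matrix; entries indexed by row and column. -/
abbrev Channel (n m : ℕ) : Type := Fin n → Fin m → ℂ

/-- `I(x; (y, H))` for `y = H x + z`, where the input `x`, the channel matrix `H` and the noise `z`
are independent with laws `μx`, `μH`, `μz`: they are realized as the three coordinates of
the product probability space. -/
def coherentInfo {n m : ℕ} (μH : Measure (Channel n m)) (μz : Measure (Fin n → ℂ))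
    (μx : Measure (Fin m → ℂ)) : ℝ≥0∞ :=
  mutualInfo (μx.prod (μH.prod μz)) (fun ω => ω.1)
    (fun ω => ((Matrix.of ω.2.1).mulVec ω.1 + ω.2.2, ω.2.1))

/-- The coherent capacity: the supremum of `I(x; (y, H))` over the admissible input laws. -/
def coherentCapacity {n m : ℕ} (μH : Measure (Channel n m)) (μz : Measure (Fin n → ℂ))
    (S : Set (Measure (Fin m → ℂ))) : ℝ≥0∞ :=
  ⨆ μx ∈ S, coherentInfo μH μz μx

/-- The input law `μx` is admissible and achieves the coherent capacity. -/
def AchievesCoherentCapacity {n m : ℕ} (μH : Measure (Channel n m)) (μz : Measure (Fin n → ℂ))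
    (S : Set (Measure (Fin m → ℂ))) (μx : Measure (Fin m → ℂ)) : Prop :=
  μx ∈ S ∧ coherentInfo μH μz μx = coherentCapacity μH μz S

end CoherentChannel

end

open MeasureTheory ProbabilityTheory InformationTheory
open scoped ENNReal

noncomputable section

namespace CoherentChannel

/-! Write `x_a` for the circular analog, with phase `ψ`, and `ν` for its output law, which is
rotation invariant. Replacing the output marginal of `x` by `ν` can only increase the divergence
(`klDiv_prod_snd_le`). Given `x_a`, redraw `ψ` from its conditional law and rotate input and output
back by `-ψ`: since `z` and `ν` are circular, this one random map sends the joint law of `x_a` and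
its output to that of `x`, and `μa × ν` to `μ × ν`. Data processing then gives
`coherentInfo_le_circularAnalog`, with no finiteness assumption. -/

/-! ### Divergence and random maps on product laws. -/

/-- The second marginal is the closest product factor in Kullback-Leibler divergence. -/
lemma klDiv_prod_snd_le {E F : Type*} [MeasurableSpace E] [StandardBorelSpace E] [Nonempty E]
    [MeasurableSpace F] (ρ : Measure (E × F)) [IsFiniteMeasure ρ] (μ : Measure E)
    [IsProbabilityMeasure μ] (ν : Measure F) [IsFiniteMeasure ν] :
    klDiv ρ (μ.prod ρ.snd) ≤ klDiv ρ (μ.prod ν) := by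
  have hsnd : (ρ.map Prod.swap).fst = ρ.snd := Measure.fst_map_swap
  have hρ : ρ.snd ⊗ₘ (ρ.map Prod.swap).condKernel = ρ.map Prod.swap := by
    rw [← hsnd]
    exact (ρ.map Prod.swap).disintegrate _
  calc klDiv ρ (μ.prod ρ.snd)
      = klDiv ((ρ.map Prod.swap).map Prod.swap) ((ρ.snd.prod μ).map Prod.swap) := by
        rw [Measure.prod_swap, Measure.map_map measurable_swap measurable_swap,
          Prod.swap_swap_eq, Measure.map_id]
    _ ≤ klDiv (ρ.map Prod.swap) (ρ.snd.prod μ) := klDiv_map_le _ _ measurable_swap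
    _ ≤ klDiv (ρ.map Prod.swap) (ν.prod μ) := by
        -- Chain rule: the right side exceeds the left by the divergence of `ρ.snd` from `ν`. The
        -- swap makes the output the coordinate one conditions on.
        rw [← hρ, ← Measure.compProd_const, ← Measure.compProd_const,
          klDiv_compProd_eq_add ρ.snd ν]
        exact le_add_self
    _ = klDiv (ρ.map Prod.swap) ((μ.prod ν).map Prod.swap) := by rw [Measure.prod_swap]
    _ ≤ klDiv ρ (μ.prod ν) := klDiv_map_le _ _ measurable_swap

/-- Drawing `t` from `κ x` and, independently, an output `Y (x, w)` can be done in either order. -/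
lemma map_prod_compProd_comap {X W T B : Type*} [MeasurableSpace X] [MeasurableSpace W]
    [MeasurableSpace T] [MeasurableSpace B] (μ : Measure X) [IsFiniteMeasure μ]
    (N : Measure W) [IsFiniteMeasure N] (κ : Kernel X T) [IsMarkovKernel κ]
    {Y : X × W → B} (hY : Measurable Y) :
    ((μ.prod N).map fun p => (p.1, Y p)) ⊗ₘ (κ.comap Prod.fst measurable_fst) =
      ((μ ⊗ₘ κ).prod N).map fun q => ((q.1.1, Y (q.1.1, q.2)), q.1.2) := by
  refine Measure.ext_of_lintegral _ fun f hf => ?_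
  have hfκ := hf.lintegral_kernel_prod_right' (κ := κ.comap Prod.fst (measurable_fst (β := B)))
  have hY' : Measurable fun p : X × W => (p.1, Y p) := by fun_prop
  have hfY : Measurable fun a : X × W =>
      ∫⁻ b, f ((a.1, Y a), b) ∂(κ.comap Prod.fst (measurable_fst (β := B))) (a.1, Y a) :=
    hfκ.comp hY'
  rw [Measure.lintegral_compProd hf, lintegral_map hfκ hY', lintegral_map hf (by fun_prop),
    lintegral_prod _ hfY.aemeasurable, lintegral_prod _ (by fun_prop),
    Measure.lintegral_compProd (by fun_prop)]
  refine lintegral_congr fun x => ?_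
  simp only [Kernel.comap_apply]
  exact lintegral_lintegral_swap (by fun_prop)

/-- Transforming a coordinate by independently drawn measure-preserving maps does not change a
product law. -/
lemma map_prod_random_invariant {T X W : Type*} [MeasurableSpace T] [MeasurableSpace X]
    [MeasurableSpace W] (τ : Measure T) [IsProbabilityMeasure τ] (μ : Measure X)
    [IsFiniteMeasure μ] (N : Measure W) [IsFiniteMeasure N] {R : T → W → W}
    (hR : Measurable (Function.uncurry R)) (hN : ∀ t, N.map (R t) = N) :
    ((τ.prod μ).prod N).map (fun q => (q.1.2, R q.1.1 q.2)) = μ.prod N := by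
  have hR' : ∀ t, Measurable (R t) := fun t =>
    hR.comp (f := fun w => (t, w)) (by fun_prop)
  have hR'' : Measurable fun q : (T × X) × W => R q.1.1 q.2 :=
    hR.comp (f := fun q : (T × X) × W => (q.1.1, q.2)) (by fun_prop)
  refine Measure.ext_of_lintegral _ fun f hf => ?_
  have key : ∀ t x, ∫⁻ w, f (x, R t w) ∂N = ∫⁻ w, f (x, w) ∂N := fun t x => by
    conv_rhs => rw [← hN t]
    rw [lintegral_map (by fun_prop) (hR' t)]
  rw [lintegral_map hf (by fun_prop), lintegral_prod _ (by fun_prop)]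
  simp_rw [key]
  rw [lintegral_prod _ (by fun_prop), lintegral_prod _ (by fun_prop)]
  simp

/-! ### Rotations and the uniform phase. -/

/-- The scalar `e^{2πiθ}`. -/
def phase (θ : ℝ) : ℂ := Complex.exp (2 * Real.pi * θ * Complex.I)

@[fun_prop]
lemma measurable_phase : Measurable phase := by
  unfold phase
  fun_prop

lemma phase_add (a b : ℝ) : phase (a + b) = phase a * phase b := by
  simp only [phase, ← Complex.exp_add]
  push_cast
  ring_nf

lemma phase_neg_mul_phase (θ : ℝ) : phase (-θ) * phase θ = 1 := by
  rw [← phase_add]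
  simp [phase]

lemma phase_eq_toCircle (θ : ℝ) : phase θ = AddCircle.toCircle (θ : UnitAddCircle) := by
  rw [AddCircle.toCircle_apply_mk, Circle.coe_exp, phase]
  simp

lemma phase_fract (θ : ℝ) : phase (Int.fract θ) = phase θ := by
  have h : phase (Int.floor θ : ℝ) = 1 := by
    rw [phase, Complex.exp_eq_one_iff]
    exact ⟨⌊θ⌋, by push_cast; ring⟩
  conv_rhs => rw [← Int.floor_add_fract θ, phase_add, h, one_mul]

/-- On the circle `ℝ/ℤ` this is translation invariance of the measure. -/
lemma lintegral_phase_add (g : ℂ → ℝ≥0∞) (θ : ℝ) :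
    ∫⁻ ψ in Set.Ico (0 : ℝ) 1, g (phase (θ + ψ)) = ∫⁻ ψ in Set.Ico (0 : ℝ) 1, g (phase ψ) := by
  have h := fun f : UnitAddCircle → ℝ≥0∞ => UnitAddCircle.lintegral_preimage 0 f
  simp only [zero_add] at h
  rw [restrict_Ico_eq_restrict_Ioc]
  simp only [phase_eq_toCircle, AddCircle.coe_add]
  rw [h fun b => g (AddCircle.toCircle ((θ : UnitAddCircle) + b)),
    h fun b => g (AddCircle.toCircle b)]
  exact lintegral_add_left_eq_self (fun b : UnitAddCircle => g (AddCircle.toCircle b)) _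

/-- Circularity only speaks of angles in `[0,1)`; reducing mod 1 allows the rotations by `-ψ` needed
later. -/
lemma IsCircular.map_phase_smul {k : ℕ} {μ : Measure (Fin k → ℂ)} (h : IsCircular μ) (θ : ℝ) :
    μ.map (fun x => phase θ • x) = μ := by
  rw [← phase_fract]
  exact h _ ⟨Int.fract_nonneg θ, Int.fract_lt_one θ⟩

/-- The uniform distribution on `[0,1)`. -/
abbrev uniformPhase : Measure ℝ := (volume : Measure ℝ).restrict (Set.Ico 0 1)

instance : IsProbabilityMeasure uniformPhase := ⟨by simp⟩

lemma circularAnalog_eq {k : ℕ} (μ : Measure (Fin k → ℂ)) :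
    circularAnalog μ = (uniformPhase.prod μ).map fun p => phase p.1 • p.2 := rfl

instance {k : ℕ} (μ : Measure (Fin k → ℂ)) [IsProbabilityMeasure μ] :
    IsProbabilityMeasure (circularAnalog μ) := by
  rw [circularAnalog_eq]
  exact Measure.isProbabilityMeasure_map (by fun_prop)

lemma isCircular_circularAnalog {k : ℕ} (μ : Measure (Fin k → ℂ)) [IsProbabilityMeasure μ] :
    IsCircular (circularAnalog μ) := by
  intro θ _
  change (circularAnalog μ).map (fun x => phase θ • x) = circularAnalog μ
  rw [circularAnalog_eq, Measure.map_map (by fun_prop) (by fun_prop)]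
  refine Measure.ext_of_lintegral _ fun f hf => ?_
  rw [lintegral_map hf (by fun_prop), lintegral_map hf (by fun_prop),
    -- With `x` fixed, the extra rotation only shifts the uniform phase.
    lintegral_prod_symm _ (by fun_prop), lintegral_prod_symm _ (by fun_prop)]
  refine lintegral_congr fun x => ?_
  simp only [Function.comp_apply, smul_smul, ← phase_add]
  exact lintegral_phase_add (fun c => f (c • x)) θ

/-! ### Rotational symmetry of the channel. -/

/-- The channel output `(H x + z, H)` as a function of `(x, (H, z))`. -/
def output {n m : ℕ} (p : (Fin m → ℂ) × Channel n m × (Fin n → ℂ)) :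
    (Fin n → ℂ) × Channel n m :=
  ((Matrix.of p.2.1).mulVec p.1 + p.2.2, p.2.1)

@[fun_prop]
lemma measurable_output {n m : ℕ} : Measurable (output (n := n) (m := m)) := by
  refine Measurable.prodMk (measurable_pi_lambda _ fun i => ?_) (by fun_prop)
  simp only [Pi.add_apply, Matrix.mulVec, dotProduct, Matrix.of_apply]
  fun_prop

/-- Multiplication of the second component by `e^{2πiθ}`. -/
def rotateSnd {A : Type*} {n : ℕ} (θ : ℝ) (p : A × (Fin n → ℂ)) : A × (Fin n → ℂ) :=
  (p.1, phase θ • p.2)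

/-- Multiplication of the first component by `e^{2πiθ}`. -/
def rotateFst {A : Type*} {n : ℕ} (θ : ℝ) (p : (Fin n → ℂ) × A) : (Fin n → ℂ) × A :=
  (phase θ • p.1, p.2)

lemma rotateFst_output {n m : ℕ} (θ : ℝ) (x : Fin m → ℂ) (w : Channel n m × (Fin n → ℂ)) :
    rotateFst θ (output (x, w)) = output (phase θ • x, rotateSnd θ w) := by
  simp [rotateFst, rotateSnd, output, Matrix.mulVec_smul]

lemma IsCircular.map_rotateSnd_prod {A : Type*} [MeasurableSpace A] {n : ℕ} (α : Measure A)
    [IsFiniteMeasure α] {μ : Measure (Fin n → ℂ)} [IsFiniteMeasure μ] (h : IsCircular μ) (θ : ℝ) :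
    (α.prod μ).map (rotateSnd θ) = α.prod μ := by
  have := Measure.map_prod_map α μ measurable_id (g := fun x => phase θ • x) (by fun_prop)
  rw [Measure.map_id, h.map_phase_smul] at this
  exact this.symm

/-- Rotating `y` amounts to rotating `x` and `z` together, and both are circular and independent. -/
lemma map_rotateFst_map_output {n m : ℕ} (μH : Measure (Channel n m)) [IsProbabilityMeasure μH]
    {μz : Measure (Fin n → ℂ)} [IsProbabilityMeasure μz] (hz : IsCircular μz)
    {μ : Measure (Fin m → ℂ)} [IsProbabilityMeasure μ] (hμ : IsCircular μ) (θ : ℝ) :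
    ((μ.prod (μH.prod μz)).map output).map (rotateFst θ) = (μ.prod (μH.prod μz)).map output := by
  have hs : Measurable (rotateSnd (A := Channel n m) (n := n) θ) := by
    unfold rotateSnd; fun_prop
  have hf : Measurable (rotateFst (A := Channel n m) (n := n) θ) := by
    unfold rotateFst; fun_prop
  have := Measure.map_prod_map μ (μH.prod μz) (f := fun x => phase θ • x) (by fun_prop) hs
  rw [hμ.map_phase_smul, hz.map_rotateSnd_prod μH] at this
  conv_rhs => rw [this, Measure.map_map measurable_output (by fun_prop)]
  rw [Measure.map_map hf measurable_output]
  congr 1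
  ext1 p
  exact rotateFst_output θ p.1 p.2

lemma coherentInfo_eq {n m : ℕ} (μH : Measure (Channel n m)) [IsProbabilityMeasure μH]
    (μz : Measure (Fin n → ℂ)) [IsProbabilityMeasure μz] (μ : Measure (Fin m → ℂ)) :
    coherentInfo μH μz μ = klDiv ((μ.prod (μH.prod μz)).map fun p => (p.1, output p))
      (μ.prod ((μ.prod (μH.prod μz)).map output)) := by
  change klDiv _ (((μ.prod (μH.prod μz)).map Prod.fst).prod _) = _
  rw [Measure.map_fst_prod, measure_univ, one_smul]
  rfl

/-! ### Comparison with the circular analog. -/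

/-- Passing to the circular analog of the input does not decrease the mutual information. -/
theorem coherentInfo_le_circularAnalog {n m : ℕ} (μH : Measure (Channel n m))
    [IsProbabilityMeasure μH] {μz : Measure (Fin n → ℂ)} [IsProbabilityMeasure μz]
    (hz : IsCircular μz) (μ : Measure (Fin m → ℂ)) [IsProbabilityMeasure μ] :
    coherentInfo μH μz μ ≤ coherentInfo μH μz (circularAnalog μ) := by
  rw [coherentInfo_eq, coherentInfo_eq]
  set N := μH.prod μz
  set μa := circularAnalog μ
  set ν := (μa.prod N).map output
  have : IsProbabilityMeasure ν := Measure.isProbabilityMeasure_map (by fun_prop)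
  have : IsProbabilityMeasure ((μ.prod N).map fun p => (p.1, output p)) :=
    Measure.isProbabilityMeasure_map (by fun_prop)
  have : IsProbabilityMeasure ((μa.prod N).map fun p => (p.1, output p)) :=
    Measure.isProbabilityMeasure_map (by fun_prop)
  let s : ℝ × (Fin m → ℂ) → (Fin m → ℂ) × ℝ := fun p => (phase p.1 • p.2, p.1)
  have hs : Measurable s := by fun_prop
  -- Joint law of `(x_a, ψ)`; its conditional kernel recovers a phase from `x_a` alone.
  let ξ := (uniformPhase.prod μ).map s
  have : IsProbabilityMeasure ξ := Measure.isProbabilityMeasure_map (by fun_prop)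
  have hξ : μa ⊗ₘ ξ.condKernel = ξ := by
    have : ξ.fst = μa := by
      rw [Measure.fst, Measure.map_map measurable_fst hs]
      rfl
    rw [← this]
    exact ξ.disintegrate _
  let G : ((Fin m → ℂ) × ((Fin n → ℂ) × Channel n m)) × ℝ →
      (Fin m → ℂ) × ((Fin n → ℂ) × Channel n m) :=
    fun q => (phase (-q.2) • q.1.1, rotateFst (-q.2) q.1.2)
  have hG : Measurable G := by
    simp only [G, rotateFst]
    fun_prop
  -- Undoing the phase leaves the output of `x` with noise rotated by `-ψ`; circular noise makes
  -- that noise independent of `ψ`.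
  have hP : ((((μa.prod N).map fun p => (p.1, output p)) ⊗ₘ
      (ξ.condKernel.comap Prod.fst measurable_fst)).map G) =
      (μ.prod N).map fun p => (p.1, output p) := by
    have hR : Measurable (Function.uncurry fun t : ℝ =>
        rotateSnd (A := Channel n m) (n := n) (-t)) := by
      unfold rotateSnd Function.uncurry
      fun_prop
    have inv := map_prod_random_invariant uniformPhase μ N hR
      fun t => hz.map_rotateSnd_prod μH (-t)
    have hR' : Measurable fun q : (ℝ × (Fin m → ℂ)) × Channel n m × (Fin n → ℂ) =>
        (q.1.2, rotateSnd (-q.1.1) q.2) := by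
      unfold rotateSnd
      fun_prop
    rw [map_prod_compProd_comap _ _ _ measurable_output, hξ, Measure.map_map hG (by fun_prop)]
    have e := Measure.map_prod_map (uniformPhase.prod μ) N hs measurable_id
    rw [Measure.map_id] at e
    rw [e, Measure.map_map (by fun_prop) (by fun_prop)]
    conv_rhs => rw [← inv, Measure.map_map (by fun_prop) hR']
    congr 1
    ext1 q
    simp [G, s, rotateFst_output, smul_smul, phase_neg_mul_phase]
  have hQ : (((μa.prod ν) ⊗ₘ (ξ.condKernel.comap Prod.fst measurable_fst)).map G) =
      μ.prod ν := by
    have hR : Measurable (Function.uncurry fun t : ℝ =>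
        rotateFst (A := Channel n m) (n := n) (-t)) := by
      unfold rotateFst Function.uncurry
      fun_prop
    have inv := map_prod_random_invariant uniformPhase μ ν hR
      fun t => map_rotateFst_map_output μH hz (isCircular_circularAnalog μ) (-t)
    -- Here the "output" is the independent coordinate itself, so `ν` takes the role of the noise.
    have h := map_prod_compProd_comap μa ν ξ.condKernel measurable_snd
    simp only [Prod.mk.eta, Measure.map_id'] at h
    rw [h, hξ, Measure.map_map hG (by fun_prop)]
    have e := Measure.map_prod_map (uniformPhase.prod μ) ν hs measurable_id
    rw [Measure.map_id] at e
    rw [e, Measure.map_map (by fun_prop) (by fun_prop)]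
    conv_rhs => rw [← inv]
    congr 1
    ext1 q
    simp [G, s, smul_smul, phase_neg_mul_phase]
  have hsnd : ((μ.prod N).map fun p => (p.1, output p)).snd = (μ.prod N).map output := by
    rw [Measure.snd, Measure.map_map measurable_snd (by fun_prop)]
    rfl
  calc klDiv ((μ.prod N).map fun p => (p.1, output p)) (μ.prod ((μ.prod N).map output))
      ≤ klDiv ((μ.prod N).map fun p => (p.1, output p)) (μ.prod ν) := by
        rw [← hsnd]
        exact klDiv_prod_snd_le _ _ _
    _ ≤ klDiv (((μa.prod N).map fun p => (p.1, output p)) ⊗ₘ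
          (ξ.condKernel.comap Prod.fst measurable_fst))
        ((μa.prod ν) ⊗ₘ (ξ.condKernel.comap Prod.fst measurable_fst)) := by
        rw [← hP, ← hQ]
        exact klDiv_map_le _ _ hG
    -- Appending the same Markov kernel to both laws leaves the divergence unchanged.
    _ = klDiv ((μa.prod N).map fun p => (p.1, output p)) (μa.prod ν) :=
        klDiv_compProd_left _ _ _

lemma AchievesCoherentCapacity.circularAnalog {n m : ℕ} {μH : Measure (Channel n m)}
    [IsProbabilityMeasure μH] {μz : Measure (Fin n → ℂ)} [IsProbabilityMeasure μz]
    (hz : IsCircular μz) {S : Set (Measure (Fin m → ℂ))} (hclosed : CircularClosed S)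
    {μ : Measure (Fin m → ℂ)} [IsProbabilityMeasure μ]
    (h : AchievesCoherentCapacity μH μz S μ) :
    AchievesCoherentCapacity μH μz S (circularAnalog μ) := by
  refine ⟨hclosed μ h.1, le_antisymm ?_ ?_⟩
  · exact le_iSup₂_of_le _ (hclosed μ h.1) le_rfl
  · rw [← h.2]
    exact coherentInfo_le_circularAnalog μH hz μ

end CoherentChannel

end

theorem mainTheorem7 {n m : ℕ}
    (μH : Measure (CoherentChannel.Channel n m)) [IsProbabilityMeasure μH]
    (μz : Measure (Fin n → ℂ)) [IsProbabilityMeasure μz]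
    (hz : CoherentChannel.IsCircular μz)
    (S : Set (Measure (Fin m → ℂ)))
    (hS : ∀ μ ∈ S, IsProbabilityMeasure μ)
    (hclosed : CoherentChannel.CircularClosed S)
    (hopt : ∃ μ, CoherentChannel.AchievesCoherentCapacity μH μz S μ) :
    (∃ μ, CoherentChannel.IsCircular μ ∧
      CoherentChannel.AchievesCoherentCapacity μH μz S μ) ∧
    ∀ μ, CoherentChannel.AchievesCoherentCapacity μH μz S μ →
      CoherentChannel.IsCircular (CoherentChannel.circularAnalog μ) ∧
      CoherentChannel.AchievesCoherentCapacity μH μz S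
        (CoherentChannel.circularAnalog μ) := by
  have key : ∀ μ, CoherentChannel.AchievesCoherentCapacity μH μz S μ →
      CoherentChannel.IsCircular (CoherentChannel.circularAnalog μ) ∧
      CoherentChannel.AchievesCoherentCapacity μH μz S
        (CoherentChannel.circularAnalog μ) := fun μ h => by
    have := hS μ h.1
    exact ⟨CoherentChannel.isCircular_circularAnalog μ, h.circularAnalog hz hclosed⟩
  obtain ⟨μ, hμ⟩ := hopt
  exact ⟨⟨_, key μ hμ⟩, key⟩
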